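/- Call Gessel walk a walk in the quadrant $\mathbb{Z}_+^2$ starting at $(0,0)$ all of whose steps belong to $\{(1,0),(1,1),(-1,0),(-1,-1)\}$; let $q(i,j,k)$ be the number of Gessel walks with $k$ steps ending at $(i,j)$, and let $Q(x,y,z)=\sum_{i,j,k\ge 0}q(i,j,k)x^iy^jz^k$, a series which converges absolutely for $|x|\le 1$, $|y|\le 1$, $|z|<1/4$. Fix $z\in\,]0,1/4[$ and put $$L(x,y,z)=xyz\Big[\tfrac1x+\tfrac1{xy}+x+xy-\tfrac1z\Big]=zy(y+1)x^2-yx+z(y+1)=zx^2y^2+(zx^2-x+z)y+z .$$ Let $X_0(y,z)$ be the root $x$ of smaller modulus of $L(x,y,z)=0$, and $Y_0(x,z)$ the root $y$ of smaller modulus of $L(x,y,z)=0$ (if the equation degenerates to one of degree one, its only root). Let $$x_{1}=\frac{1+2z-\sqrt{1+4z}}{2z},\quad x_{2}=\frac{1-2z-\sqrt{1-4z}}{2z},\quad x_{3}=\frac{1-2z+\sqrt{1-4z}}{2z},\quad x_{4}=\frac{1+2z+\sqrt{1+4z}}{2z},$$ $$y_1=0,\quad y_{2}=\frac{1-8z^2-\sqrt{1-16z^2}}{8z^2},\quad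 y_{3}=\frac{1-8z^2+\sqrt{1-16z^2}}{8z^2},\quad y_4=\infty .$$ Theorem. The functions $x\mapsto zQ(x,0,z)$ and $y\mapsto z(y+1)Q(0,y,z)$ can be continued as holomorphic functions from the closed unit disc to $\mathbb{C}\setminus[x_3,x_4]$ and to $\mathbb{C}\setminus[y_3,y_4]=\mathbb{C}\setminus[y_3,+\infty[$ respectively. Writing $zQ(x,0,z)$ and $z(y+1)Q(0,y,z)$ also for these continuations, for every $y\in\mathbb{C}\setminus([y_1,y_2]\cup[y_3,y_4])$ one has $X_0(y,z)\notin[x_3,x_4]$ and $$zQ(X_0(y,z),0,z)+z(y+1)Q(0,y,z)-zQ(0,0,z)-X_0(y,z)\,y=0,$$ and for every $x\in\mathbb{C}\setminus([x_1,x_2]\cup[x_3,x_4])$ one has $Y_0(x,z)\notin[y_3,y_4]$ and $$zQ(x,0,z)+z(Y_0(x,z)+1)Q(0,Y_0(x,z),z)-zQ(0,0,z)-x\,Y_0(x,z)=0.$$ -/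

import Mathlib

namespace Gessel

/-- A single step of a Gessel walk inside the quadrant: East, North-East, West or South-West.
Since coordinates are natural numbers, a step never leaves the quadrant. -/
def IsStep (p r : ℕ × ℕ) : Prop :=
  (r.1 = p.1 + 1 ∧ r.2 = p.2) ∨
  (r.1 = p.1 + 1 ∧ r.2 = p.2 + 1) ∨
  (p.1 = r.1 + 1 ∧ p.2 = r.2) ∨
  (p.1 = r.1 + 1 ∧ p.2 = r.2 + 1)

/-- `w` lists the successive positions of a Gessel walk of length `k` from `(0,0)` to `(i,j)`. -/
def IsWalk (i j k : ℕ) (w : Fin (k + 1) → ℕ × ℕ) : Prop :=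
  w 0 = (0, 0) ∧ w (Fin.last k) = (i, j) ∧ ∀ m : Fin k, IsStep (w m.castSucc) (w m.succ)

/-- The number of Gessel walks of length `k` starting at `(0,0)` and ending at `(i,j)`. -/
noncomputable def q (i j k : ℕ) : ℕ :=
  Nat.card {w : Fin (k + 1) → ℕ × ℕ // IsWalk i j k w}

/-- The general term `q(i,j,k) x^i y^j z^k` of the generating function. -/
noncomputable def QTerm (x y z : ℂ) (p : ℕ × ℕ × ℕ) : ℂ :=
  (q p.1 p.2.1 p.2.2 : ℂ) * x ^ p.1 * y ^ p.2.1 * z ^ p.2.2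

/-- The generating function `Q(x,y,z)` of Gessel walks (sum of the power series). -/
noncomputable def Q (x y z : ℂ) : ℂ := ∑' p : ℕ × ℕ × ℕ, QTerm x y z p

/-- The kernel `x y z (1/x + 1/(x y) + x + x y - 1/z)`, as a polynomial. -/
def kernel (x y z : ℂ) : ℂ := z * y + z + z * x ^ 2 * y + z * x ^ 2 * y ^ 2 - x * y

/-- The root of smaller modulus of `a t² + b t + c`. When `a = 0` the second root is infinite,
and the value is the root of `b t + c`. The square root is the principal one, and which of
its two determinations is used does not matter, except possibly to choose between two roots of
equal modulus. -/
noncomputable def smallRoot (a b c : ℂ) : ℂ :=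
  if a = 0 then -c / b
  else if ‖(-b + (b ^ 2 - 4 * a * c) ^ (1 / 2 : ℂ)) / (2 * a)‖
        ≤ ‖(-b - (b ^ 2 - 4 * a * c) ^ (1 / 2 : ℂ)) / (2 * a)‖
    then (-b + (b ^ 2 - 4 * a * c) ^ (1 / 2 : ℂ)) / (2 * a)
    else (-b - (b ^ 2 - 4 * a * c) ^ (1 / 2 : ℂ)) / (2 * a)

/-- The branch `X₀(y,z)`: the root of smaller modulus of the kernel, as a polynomial in `x`. -/
noncomputable def X₀ (y z : ℂ) : ℂ := smallRoot (z * y * (y + 1)) (-y) (z * (y + 1))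

/-- The branch `Y₀(x,z)`: the root of smaller modulus of the kernel, as a polynomial in `y`. -/
noncomputable def Y₀ (x z : ℂ) : ℂ := smallRoot (z * x ^ 2) (z * x ^ 2 - x + z) z

/-! The branch points (with `y₁ = 0` and `y₄ = ∞`). -/

noncomputable def x₁ (z : ℝ) : ℝ := (1 + 2 * z - √(1 + 4 * z)) / (2 * z)
noncomputable def x₂ (z : ℝ) : ℝ := (1 - 2 * z - √(1 - 4 * z)) / (2 * z)
noncomputable def x₃ (z : ℝ) : ℝ := (1 - 2 * z + √(1 - 4 * z)) / (2 * z)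
noncomputable def x₄ (z : ℝ) : ℝ := (1 + 2 * z + √(1 + 4 * z)) / (2 * z)

noncomputable def y₂ (z : ℝ) : ℝ := (1 - 8 * z ^ 2 - √(1 - 16 * z ^ 2)) / (8 * z ^ 2)
noncomputable def y₃ (z : ℝ) : ℝ := (1 - 8 * z ^ 2 + √(1 - 16 * z ^ 2)) / (8 * z ^ 2)

/-- The cut `[x₁, x₂]`. -/
noncomputable def cutX12 (z : ℝ) : Set ℂ := Complex.ofReal '' Set.Icc (x₁ z) (x₂ z)
/-- The cut `[x₃, x₄]`. -/
noncomputable def cutX34 (z : ℝ) : Set ℂ := Complex.ofReal '' Set.Icc (x₃ z) (x₄ z)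
/-- The cut `[y₁, y₂] = [0, y₂]`. -/
noncomputable def cutY12 (z : ℝ) : Set ℂ := Complex.ofReal '' Set.Icc 0 (y₂ z)
/-- The cut `[y₃, y₄] = [y₃, ∞)`. -/
noncomputable def cutY34 (z : ℝ) : Set ℂ := Complex.ofReal '' Set.Ici (y₃ z)

/-! Sanity facts: `smallRoot` is a root, of minimal modulus among all roots. -/

theorem smallRoot_spec {a b c : ℂ} (h : a ≠ 0 ∨ b ≠ 0) :
    a * smallRoot a b c ^ 2 + b * smallRoot a b c + c = 0 ∧
      ∀ t : ℂ, a * t ^ 2 + b * t + c = 0 → ‖smallRoot a b c‖ ≤ ‖t‖ := by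
  by_cases ha : a = 0
  · have hb : b ≠ 0 := by tauto
    subst ha
    simp only [smallRoot, if_true]
    refine ⟨by field_simp; ring, fun t ht => ?_⟩
    have : t = -c / b := by
      field_simp
      linear_combination ht
    rw [this]
  · have hs : ((b ^ 2 - 4 * a * c) ^ (1 / 2 : ℂ)) ^ 2 = b ^ 2 - 4 * a * c := by
      rw [← Complex.cpow_nat_mul]
      norm_num
    simp only [smallRoot, if_neg ha]
    generalize (b ^ 2 - 4 * a * c) ^ (1 / 2 : ℂ) = s at hs ⊢
    have key : ∀ t : ℂ, a * t ^ 2 + b * t + c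
        = a * (t - (-b + s) / (2 * a)) * (t - (-b - s) / (2 * a)) := by
      intro t
      field_simp
      linear_combination hs
    constructor
    · rw [key]
      split_ifs <;> ring
    · intro t ht
      rw [key] at ht
      rcases mul_eq_zero.1 ht with h1 | h1
      · have h2 : t = (-b + s) / (2 * a) := by
          rcases mul_eq_zero.1 h1 with h3 | h3
          · exact absurd h3 ha
          · exact sub_eq_zero.1 h3
        rw [h2]
        split_ifs with h4
        · exact le_rfl
        · exact (not_le.1 h4).le
      · rw [sub_eq_zero.1 h1]
        split_ifs with h4
        · exact h4
        · exact le_rfl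

theorem X₀_spec {y : ℂ} (z : ℂ) (hy : y ≠ 0) :
    kernel (X₀ y z) y z = 0 ∧ ∀ x : ℂ, kernel x y z = 0 → ‖X₀ y z‖ ≤ ‖x‖ := by
  have h := smallRoot_spec (a := z * y * (y + 1)) (b := -y) (c := z * (y + 1))
    (Or.inr (neg_ne_zero.2 hy))
  refine ⟨?_, fun x hx => h.2 x ?_⟩
  · have h1 := h.1
    unfold kernel X₀
    linear_combination h1
  · unfold kernel at hx
    linear_combination hx

theorem Y₀_spec (x : ℂ) {z : ℂ} (hz : z ≠ 0) :
    kernel x (Y₀ x z) z = 0 ∧ ∀ y : ℂ, kernel x y z = 0 → ‖Y₀ x z‖ ≤ ‖y‖ := by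
  have h := smallRoot_spec (a := z * x ^ 2) (b := z * x ^ 2 - x + z) (c := z) (by
    by_cases hx : x = 0
    · right
      simpa [hx] using hz
    · left
      exact mul_ne_zero hz (pow_ne_zero 2 hx))
  refine ⟨?_, fun y hy => h.2 y ?_⟩
  · have h1 := h.1
    unfold kernel Y₀
    linear_combination h1
  · unfold kernel at hy
    linear_combination hy

end Gessel

namespace Gessel

/-! Splitting off the last step gives the functional equation `kernel_mul_Q`, so the desired
relation holds at every zero of the kernel inside the region of convergence. As 4z < 1, that region
lets one of the variables range over a disc of radius r > 1 while the other stays in the closed unit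
disc.

The product of the two roots y of the kernel is 1/x², that of the two roots x is 1/y. Hence |x Y₀| ≤
1 and |X₀|²|y| ≤ 1: once |x| ≥ 1 the root Y₀ lies in the unit disc, and symmetrically. Solving the
relation for its first term defines the continuation F on |x| ≥ 1. It agrees with the series on 1 ≤
|x| < r, and it is holomorphic off [x₃, x₄] because Y₀ branches only where the normalised
discriminant 1 - 4ac/b² leaves the slit plane. G is built in the same way.

There remain the y with |X₀(y)| > 1. Then |X₀ y| < 1, which rules out X₀ ∈ [x₃, x₄], where |xy| = 1
(`norm_mul_eq_one_of_mem_cutX34`), and makes y the strictly smaller root over X₀. So y = Y₀(X₀(y)),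
and the relation is the one defining F at X₀(y). -/

/-! ### Recurrences for the number of walks -/

theorem isWalk_succ_iff {i j k : ℕ} {w : Fin (k + 2) → ℕ × ℕ} :
    IsWalk i j (k + 1) w ↔
      IsStep (w (Fin.last k).castSucc) (i, j) ∧ w (Fin.last (k + 1)) = (i, j) ∧
      IsWalk (w (Fin.last k).castSucc).1 (w (Fin.last k).castSucc).2 k (Fin.init w) := by
  unfold IsWalk
  constructor
  · rintro ⟨h0, h1, h2⟩
    refine ⟨?_, h1, h0, rfl, fun m => h2 m.castSucc⟩
    have := h2 (Fin.last k)
    rwa [Fin.succ_last, h1] at this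
  · rintro ⟨h0, h1, h2, -, h3⟩
    refine ⟨h2, h1, fun m => ?_⟩
    induction m using Fin.lastCases with
    | last => rw [Fin.succ_last, h1]; exact h0
    | cast m => exact h3 m

/-- Removing the last step of a walk. -/
def walkSuccEquiv (i j k : ℕ) :
    {w : Fin (k + 2) → ℕ × ℕ // IsWalk i j (k + 1) w} ≃
      Σ r : {r : ℕ × ℕ // IsStep r (i, j)}, {w : Fin (k + 1) → ℕ × ℕ // IsWalk r.1.1 r.1.2 k w} where
  toFun w := ⟨⟨w.1 (Fin.last k).castSucc, (isWalk_succ_iff.1 w.2).1⟩,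
    ⟨Fin.init w.1, (isWalk_succ_iff.1 w.2).2.2⟩⟩
  invFun s := ⟨Fin.snoc (α := fun _ => ℕ × ℕ) s.2.1 (i, j), by
    have h : s.2.1 (Fin.last k) = s.1.1 := s.2.2.2.1
    rw [isWalk_succ_iff, Fin.snoc_castSucc, Fin.snoc_last, Fin.init_snoc, h]
    exact ⟨s.1.2, rfl, s.2.2⟩⟩
  left_inv w := by
    apply Subtype.ext
    have h := (isWalk_succ_iff.1 w.2).2.1
    show Fin.snoc (α := fun _ => ℕ × ℕ) (Fin.init w.1) (i, j) = w.1
    rw [← h]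
    exact Fin.snoc_init_self w.1
  right_inv s := by
    obtain ⟨⟨r, hr⟩, ⟨w, hw⟩⟩ := s
    have h : w (Fin.last k) = r := hw.2.1
    subst h
    refine Sigma.ext (Subtype.ext ?_) ?_
    · simp
    · simp only [Fin.init_snoc]
      congr! <;> simp

theorem finite_isStep (p : ℕ × ℕ) : Finite {r : ℕ × ℕ // IsStep r p} := by
  refine Set.Finite.to_subtype (s := {r | IsStep r p})
    ((Set.finite_Iic ((p.1 + 1, p.2 + 1) : ℕ × ℕ)).subset fun r hr => ?_)
  simp only [Set.mem_ofPred_eq, IsStep, Set.mem_Iic, Prod.le_def] at *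
  omega

/-- `Nat.card` is 0 on infinite types, so the count is additive over the last step only once
finiteness is known. -/
theorem finite_isWalk (i j k : ℕ) : Finite {w : Fin (k + 1) → ℕ × ℕ // IsWalk i j k w} := by
  induction k generalizing i j with
  | zero =>
    refine Set.Finite.to_subtype (s := {w | IsWalk i j 0 w})
      ((Set.finite_singleton (fun _ => (0, 0))).subset fun w hw => ?_)
    ext1 m
    rw [show m = 0 from Subsingleton.elim (α := Fin 1) m 0]
    exact hw.1
  | succ k ih =>
    have := finite_isStep (i, j)
    have := fun r : {r : ℕ × ℕ // IsStep r (i, j)} => ih r.1.1 r.1.2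
    exact Finite.of_equiv _ (walkSuccEquiv i j k).symm

theorem q_succ_eq_sum {i j : ℕ} (S : Finset (ℕ × ℕ)) (hS : ∀ r, r ∈ S ↔ IsStep r (i, j)) (k : ℕ) :
    q i j (k + 1) = ∑ r ∈ S, q r.1 r.2 k := by
  have := finite_isStep (i, j)
  have : Fintype {r : ℕ × ℕ // IsStep r (i, j)} := Fintype.ofFinite _
  have := fun r : {r : ℕ × ℕ // IsStep r (i, j)} => finite_isWalk r.1.1 r.1.2 k
  rw [q, Nat.card_congr (walkSuccEquiv i j k), Nat.card_sigma]
  exact (Finset.sum_subtype S hS fun r => q r.1 r.2 k).symm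

theorem q_zero_zero_zero : q 0 0 0 = 1 := by
  rw [q, Nat.card_eq_one_iff_unique]
  refine ⟨⟨fun a b => ?_⟩, ⟨⟨fun _ => (0, 0), rfl, rfl, fun m => m.elim0⟩⟩⟩
  apply Subtype.ext
  ext1 m
  rw [show m = 0 from Subsingleton.elim (α := Fin 1) m 0, a.2.1, b.2.1]

theorem q_zero {i j : ℕ} (h : (i, j) ≠ (0, 0)) : q i j 0 = 0 := by
  rw [q, Nat.card_eq_zero]
  refine Or.inl ⟨fun w => h ?_⟩
  rw [← w.2.2.1, ← w.2.1]
  rfl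

theorem q_succ_zero_left (j k : ℕ) : q 0 j (k + 1) = q 1 j k + q 1 (j + 1) k := by
  rw [q_succ_eq_sum {(1, j), (1, j + 1)}]
  · rw [Finset.sum_pair (by simp)]
  · rintro ⟨a, b⟩
    simp only [Finset.mem_insert, Finset.mem_singleton, Prod.mk.injEq, IsStep]
    omega

theorem q_succ_zero_right (i k : ℕ) :
    q (i + 1) 0 (k + 1) = q i 0 k + (q (i + 2) 0 k + q (i + 2) 1 k) := by
  rw [q_succ_eq_sum {(i, 0), (i + 2, 0), (i + 2, 1)}]
  · rw [Finset.sum_insert (by simp), Finset.sum_pair (by simp)]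
  · rintro ⟨a, b⟩
    simp only [Finset.mem_insert, Finset.mem_singleton, Prod.mk.injEq, IsStep]
    omega

theorem q_succ_succ (i j k : ℕ) : q (i + 1) (j + 1) (k + 1) =
    q i (j + 1) k + (q i j k + (q (i + 2) (j + 1) k + q (i + 2) (j + 2) k)) := by
  rw [q_succ_eq_sum {(i, j + 1), (i, j), (i + 2, j + 1), (i + 2, j + 2)}]
  · rw [Finset.sum_insert (by simp), Finset.sum_insert (by simp), Finset.sum_pair (by simp)]
  · rintro ⟨a, b⟩
    simp only [Finset.mem_insert, Finset.mem_singleton, Prod.mk.injEq, IsStep]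
    omega

/-! ### Growth of `q` and convergence of the series -/

theorem q_le (i j k : ℕ) : q i j k ≤ 4 ^ k := by
  induction k generalizing i j with
  | zero =>
    by_cases h : (i, j) = (0, 0)
    · obtain ⟨rfl, rfl⟩ := Prod.mk.inj h
      simp [q_zero_zero_zero]
    · simp [q_zero h]
  | succ k ih =>
    rw [pow_succ]
    rcases i with _ | i
    · rw [q_succ_zero_left]
      linarith [ih 1 j, ih 1 (j + 1)]
    · rcases j with _ | j
      · rw [q_succ_zero_right]
        linarith [ih i 0, ih (i + 2) 0, ih (i + 2) 1]
      · rw [q_succ_succ]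
        linarith [ih i (j + 1), ih i j, ih (i + 2) (j + 1), ih (i + 2) (j + 2)]

/-- A step raises each coordinate by at most one. This lets powers of x and y be absorbed into the
decay in k, hence convergence slightly beyond the unit disc. -/
theorem q_eq_zero_of_lt {i j k : ℕ} (h : k < i ∨ k < j) : q i j k = 0 := by
  induction k generalizing i j with
  | zero => exact q_zero (by simp only [ne_eq, Prod.mk.injEq]; omega)
  | succ k ih =>
    rcases i with _ | i
    · rw [q_succ_zero_left, ih (by omega), ih (by omega)]
    · rcases j with _ | j
      · rw [q_succ_zero_right, ih (by omega), ih (by omega), ih (by omega)]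
      · rw [q_succ_succ, ih (by omega), ih (by omega), ih (by omega), ih (by omega)]

/-- A product of three geometric series of ratio `σ` dominates the terms of `Q(x,y,z)`
as soon as `4 X Y ‖z‖ ≤ σ ^ 3`, where `X, Y ≥ 1` bound `‖x‖, ‖y‖`. -/
theorem norm_QTerm_le {x y z : ℂ} {X Y σ : ℝ} (hX : 1 ≤ X) (hY : 1 ≤ Y) (hx : ‖x‖ ≤ X)
    (hy : ‖y‖ ≤ Y) (hσ0 : 0 ≤ σ) (hσ1 : σ ≤ 1) (hσ : 4 * X * Y * ‖z‖ ≤ σ ^ 3) (p : ℕ × ℕ × ℕ) :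
    ‖QTerm x y z p‖ ≤ σ ^ p.1 * (σ ^ p.2.1 * σ ^ p.2.2) := by
  obtain ⟨i, j, k⟩ := p
  simp only [QTerm, norm_mul, norm_pow, Complex.norm_natCast]
  by_cases h : k < i ∨ k < j
  · rw [q_eq_zero_of_lt h]
    simp only [Nat.cast_zero, zero_mul]
    positivity
  · push Not at h
    have hq : (q i j k : ℝ) ≤ 4 ^ k := by exact_mod_cast q_le i j k
    have h1 : ‖x‖ ^ i ≤ X ^ k :=
      (pow_le_pow_left₀ (norm_nonneg _) hx i).trans (pow_le_pow_right₀ hX h.1)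
    have h2 : ‖y‖ ^ j ≤ Y ^ k :=
      (pow_le_pow_left₀ (norm_nonneg _) hy j).trans (pow_le_pow_right₀ hY h.2)
    calc (q i j k : ℝ) * ‖x‖ ^ i * ‖y‖ ^ j * ‖z‖ ^ k ≤ 4 ^ k * X ^ k * Y ^ k * ‖z‖ ^ k := by gcongr
      _ = (4 * X * Y * ‖z‖) ^ k := by simp only [mul_pow]
      _ ≤ (σ ^ 3) ^ k := by gcongr
      _ = σ ^ (k + (k + k)) := by rw [← pow_mul]; congr 1; ring
      _ ≤ σ ^ (i + (j + k)) := pow_le_pow_of_le_one hσ0 hσ1 (by omega)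
      _ = σ ^ i * (σ ^ j * σ ^ k) := by simp only [pow_add]

theorem exists_summable_bound {X Y Z : ℝ} (hX : 1 ≤ X) (hY : 1 ≤ Y) (hZ : 0 ≤ Z)
    (h : 4 * X * Y * Z < 1) : ∃ u : ℕ × ℕ × ℕ → ℝ, Summable u ∧
      ∀ x y z : ℂ, ‖x‖ ≤ X → ‖y‖ ≤ Y → ‖z‖ ≤ Z → ∀ p, ‖QTerm x y z p‖ ≤ u p := by
  have hρ : 0 ≤ 4 * X * Y * Z := by positivity
  -- A cube root, because the decay in k is shared among the three indices i, j ≤ k and k.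
  set σ : ℝ := (4 * X * Y * Z) ^ (1 / 3 : ℝ) with hσdef
  have hσ0 : 0 ≤ σ := Real.rpow_nonneg hρ _
  have hσ1 : σ < 1 := Real.rpow_lt_one hρ h (by norm_num)
  have hσ : 4 * X * Y * Z = σ ^ 3 := by
    rw [hσdef, ← Real.rpow_natCast, ← Real.rpow_mul hρ]
    norm_num
  have hg := summable_geometric_of_lt_one hσ0 hσ1
  have hn : 0 ≤ fun n : ℕ => σ ^ n := fun n => pow_nonneg hσ0 n
  refine ⟨fun p => σ ^ p.1 * (σ ^ p.2.1 * σ ^ p.2.2),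
    hg.mul_of_nonneg (hg.mul_of_nonneg hg hn hn) hn
      (fun p => mul_nonneg (pow_nonneg hσ0 _) (pow_nonneg hσ0 _)), ?_⟩
  intro x y z hx hy hz p
  refine norm_QTerm_le hX hY hx hy hσ0 hσ1.le (le_trans ?_ hσ.le) p
  gcongr

theorem summable_QTerm {x y z : ℂ} {X Y : ℝ} (hX : 1 ≤ X) (hY : 1 ≤ Y) (hx : ‖x‖ ≤ X)
    (hy : ‖y‖ ≤ Y) (h : 4 * X * Y * ‖z‖ < 1) : Summable (QTerm x y z) := by
  obtain ⟨u, hu, hb⟩ := exists_summable_bound hX hY (norm_nonneg z) h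
  exact hu.of_norm_bounded (hb x y z hx hy le_rfl)

theorem differentiableOn_Q_left {z : ℂ} {r : ℝ} (hr : 1 ≤ r) (h : 4 * r * ‖z‖ < 1) :
    DifferentiableOn ℂ (fun x => Q x 0 z) (Metric.ball 0 r) := by
  obtain ⟨u, hu, hb⟩ := exists_summable_bound hr le_rfl (norm_nonneg z) (by linarith)
  refine Complex.differentiableOn_tsum_of_summable_norm hu (fun p => ?_) Metric.isOpen_ball
    fun p x hx => hb x 0 z (mem_ball_zero_iff.1 hx).le (by simp) le_rfl p
  unfold QTerm
  fun_prop

theorem differentiableOn_Q_right {z : ℂ} {r : ℝ} (hr : 1 ≤ r) (h : 4 * r * ‖z‖ < 1) :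
    DifferentiableOn ℂ (fun y => Q 0 y z) (Metric.ball 0 r) := by
  obtain ⟨u, hu, hb⟩ := exists_summable_bound le_rfl hr (norm_nonneg z) (by linarith)
  refine Complex.differentiableOn_tsum_of_summable_norm hu (fun p => ?_) Metric.isOpen_ball
    fun p y hy => hb 0 y z (by simp) (mem_ball_zero_iff.1 hy).le le_rfl p
  unfold QTerm
  fun_prop

/-! ### The functional equation -/

theorem Q_eq_one_at_zero (x y : ℂ) : Q x y 0 = 1 := by
  rw [Q, tsum_eq_single (0, 0, 0)]
  · simp [QTerm, q_zero_zero_zero]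
  · rintro ⟨i, j, k⟩ h
    rcases k with _ | k
    · simp only [QTerm]
      rw [q_zero]
      · simp
      · simpa using h
    · simp [QTerm]

/-- The functional equation of the generating function of Gessel walks. -/
theorem kernel_mul_Q {x y z : ℂ} {X Y : ℝ} (hX : 1 ≤ X) (hY : 1 ≤ Y) (hx : ‖x‖ ≤ X)
    (hy : ‖y‖ ≤ Y) (h : 4 * X * Y * ‖z‖ < 1) :
    kernel x y z * Q x y z = z * Q x 0 z + z * (y + 1) * Q 0 y z - z * Q 0 0 z - x * y := by
  have h0 : ‖(0 : ℂ)‖ ≤ X := by simpa using zero_le_one.trans hX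
  have h0' : ‖(0 : ℂ)‖ ≤ Y := by simpa using zero_le_one.trans hY
  have S : HasSum _ (Q x y z) := (summable_QTerm hX hY hx hy h).hasSum
  have Sx0 : HasSum _ (Q x 0 z) := (summable_QTerm hX hY hx h0' h).hasSum
  have S0y : HasSum _ (Q 0 y z) := (summable_QTerm hX hY h0 hy h).hasSum
  have S00 : HasSum _ (Q 0 0 z) := (summable_QTerm hX hY h0 h0' h).hasSum
  have Sz : HasSum (QTerm x y 0) (Q x y 0) := (summable_QTerm hX hY hx hy (by simp)).hasSum
  -- the four shifts of the array `q`, and the shift of the length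
  have e1 : Function.Injective fun p : ℕ × ℕ × ℕ => (p.1 + 1, p.2.1, p.2.2) := by
    rintro ⟨a, b, c⟩ ⟨a', b', c'⟩; simp
  have e2 : Function.Injective fun p : ℕ × ℕ × ℕ => (p.1 + 1, p.2.1 + 1, p.2.2) := by
    rintro ⟨a, b, c⟩ ⟨a', b', c'⟩; simp
  have e3 : Function.Injective fun p : ℕ × ℕ × ℕ => (p.1, p.2.1, p.2.2 + 1) := by
    rintro ⟨a, b, c⟩ ⟨a', b', c'⟩; simp
  -- Since 0⁰ = 1, setting a variable to 0 keeps exactly the terms of index 0; subtracting them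
  -- leaves a family supported on the range of the shift.
  have A1 : HasSum (fun p : ℕ × ℕ × ℕ => QTerm x y z (p.1 + 1, p.2.1, p.2.2))
      (Q x y z - Q 0 y z) := by
    have := (e1.hasSum_iff (f := fun p => QTerm x y z p - QTerm 0 y z p) (by
      rintro ⟨_ | i, j, k⟩ hp
      · simp [QTerm]
      · exact (hp ⟨(i, j, k), rfl⟩).elim)).2 (S.sub S0y)
    convert this using 2 with p
    simp [QTerm]
  have A2 : HasSum (fun p : ℕ × ℕ × ℕ => QTerm x y z (p.1 + 1, p.2.1 + 1, p.2.2))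
      (Q x y z - Q 0 y z - (Q x 0 z - Q 0 0 z)) := by
    have := (e2.hasSum_iff (f := fun p => QTerm x y z p - QTerm 0 y z p -
        (QTerm x 0 z p - QTerm 0 0 z p)) (by
      rintro ⟨_ | i, _ | j, k⟩ hp
      · simp [QTerm]
      · simp [QTerm]
      · simp [QTerm]
      · exact (hp ⟨(i, j, k), rfl⟩).elim)).2
      ((S.sub S0y).sub (Sx0.sub S00))
    convert this using 2 with p
    simp [QTerm]
  have A3 : HasSum (fun p : ℕ × ℕ × ℕ => QTerm x y z (p.1, p.2.1, p.2.2 + 1))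
      (Q x y z - 1) := by
    rw [← Q_eq_one_at_zero x y]
    have := (e3.hasSum_iff (f := fun p => QTerm x y z p - QTerm x y 0 p) (by
      rintro ⟨i, j, _ | k⟩ hp
      · simp [QTerm]
      · exact (hp ⟨(i, j, k), rfl⟩).elim)).2 (S.sub Sz)
    convert this using 2 with p
    simp [QTerm]
  -- `a` and `b` are the contributions of a last step (1,0) or (1,1), extended by zero to the axes
  -- those steps cannot reach.
  let a : ℕ × ℕ × ℕ → ℂ
    | (0, _, _) => 0
    | (i + 1, j, k) => x * QTerm x y z (i, j, k)
  let b : ℕ × ℕ × ℕ → ℂ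
    | (0, _, _) => 0
    | (_, 0, _) => 0
    | (i + 1, j + 1, k) => x * y * QTerm x y z (i, j, k)
  have B1 : HasSum a (x * Q x y z) := by
    refine (e1.hasSum_iff ?_).1 (S.mul_left x)
    rintro ⟨_ | i, j, k⟩ hp
    · rfl
    · exact (hp ⟨(i, j, k), rfl⟩).elim
  have B2 : HasSum b (x * y * Q x y z) := by
    refine (e2.hasSum_iff ?_).1 (S.mul_left (x * y))
    rintro ⟨_ | i, _ | j, k⟩ hp
    · rfl
    · rfl
    · rfl
    · exact (hp ⟨(i, j, k), rfl⟩).elim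
  have hrec : (fun p : ℕ × ℕ × ℕ => x * y * QTerm x y z (p.1, p.2.1, p.2.2 + 1)) = fun p =>
      z * (x * y * (a p + b p) + (y * QTerm x y z (p.1 + 1, p.2.1, p.2.2) +
        QTerm x y z (p.1 + 1, p.2.1 + 1, p.2.2))) := by
    ext1 p
    obtain ⟨_ | i, _ | j, k⟩ := p
    · simp only [a, b, QTerm, q_succ_zero_left]
      push_cast
      ring
    · simp only [a, b, QTerm, q_succ_zero_left]
      push_cast
      ring
    · simp only [a, b, QTerm, q_succ_zero_right]
      push_cast
      ring
    · simp only [a, b, QTerm, q_succ_succ]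
      push_cast
      ring
  have h3 := A3.mul_left (x * y)
  rw [hrec] at h3
  have key := h3.unique ((((B1.add B2).mul_left (x * y)).add ((A1.mul_left y).add A2)).mul_left z)
  unfold kernel
  linear_combination -key

/-! ### The smaller root of a quadratic, its uniqueness and holomorphy -/

/-- The roots are -2c/(b(1+s)) and, if a ≠ 0, -b(1+s)/(2a); their moduli are in the ratio |1-s| :
|1+s|, which is below 1 as Re s > 0. The first form survives a = 0. Since the product of the roots
is c/a, comparing |at²| with |c| tells them apart. -/
theorem smallRoot_formula {a b c s : ℂ} (hb : b ≠ 0) (hs : s ^ 2 = 1 - 4 * a * c / b ^ 2)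
    (hre : 0 < s.re) :
    smallRoot a b c = -2 * c / b / (1 + s) ∧
      ∀ t : ℂ, a * t ^ 2 + b * t + c = 0 → ‖a * t ^ 2‖ < ‖c‖ → t = smallRoot a b c := by
  have h1s : 1 + s ≠ 0 := fun h => by
    have := congrArg Complex.re h
    simp at this
    linarith
  have hac : 4 * (a * c) = b ^ 2 * ((1 - s) * (1 + s)) := by
    field_simp at hs
    linear_combination hs
  have hfac : ∀ t : ℂ, a * t ^ 2 + b * t + c = 0 →
      t = -2 * c / b / (1 + s) ∨ 2 * a * t = -b * (1 + s) := by
    intro t ht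
    have : (t * (b * (1 + s)) + 2 * c) * (2 * a * t + b * (1 + s)) = 0 := by
      linear_combination 2 * b * (1 + s) * ht + t * hac
    rcases mul_eq_zero.1 this with h | h
    · left
      field_simp
      linear_combination h
    · right
      linear_combination h
  have hlt : ‖1 - s‖ < ‖1 + s‖ := by
    rw [Complex.norm_def, Complex.norm_def]
    apply Real.sqrt_lt_sqrt (Complex.normSq_nonneg _)
    simp only [Complex.normSq_apply, Complex.sub_re, Complex.one_re, Complex.sub_im,
      Complex.one_im, Complex.add_re, Complex.add_im]
    nlinarith
  have hb' : 0 < ‖b‖ := norm_pos_iff.2 hb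
  have h1s' : 0 < ‖1 + s‖ := norm_pos_iff.2 h1s
  have hacn : 4 * (‖a‖ * ‖c‖) = ‖b‖ ^ 2 * (‖1 - s‖ * ‖1 + s‖) := by
    have := congrArg norm hac
    simpa only [norm_mul, norm_pow, Complex.norm_ofNat] using this
  -- the other root is strictly larger
  have hbig : ∀ t : ℂ, 2 * a * t = -b * (1 + s) → ‖c‖ < ‖a * t ^ 2‖ := by
    intro t ht
    have ha : a ≠ 0 := by
      rintro rfl
      simp [hb, h1s] at ht
    have ha' : 0 < ‖a‖ := norm_pos_iff.2 ha
    have htn : 2 * ‖a‖ * ‖t‖ = ‖b‖ * ‖1 + s‖ := by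
      have := congrArg norm ht
      simpa only [norm_mul, norm_neg, Complex.norm_ofNat] using this
    rw [norm_mul, norm_pow]
    refine lt_of_mul_lt_mul_left (a := 4 * ‖a‖) ?_ (by positivity)
    calc 4 * ‖a‖ * ‖c‖ = ‖b‖ ^ 2 * ‖1 + s‖ * ‖1 - s‖ := by linear_combination hacn
      _ < ‖b‖ ^ 2 * ‖1 + s‖ * ‖1 + s‖ := by gcongr
      _ = 4 * ‖a‖ * (‖a‖ * ‖t‖ ^ 2) := by
        linear_combination -(2 * ‖a‖ * ‖t‖ + ‖b‖ * ‖1 + s‖) * htn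
  have hspec := smallRoot_spec (a := a) (c := c) (Or.inr hb)
  have hroot : a * (-2 * c / b / (1 + s)) ^ 2 + b * (-2 * c / b / (1 + s)) + c = 0 := by
    field_simp
    linear_combination c * hac
  have hsmall : ‖a * (-2 * c / b / (1 + s)) ^ 2‖ ≤ ‖c‖ := by
    simp only [norm_mul, norm_pow, norm_div, norm_neg, Complex.norm_ofNat]
    have : ‖a‖ * (2 * ‖c‖ / ‖b‖ / ‖1 + s‖) ^ 2 = ‖c‖ * (‖1 - s‖ / ‖1 + s‖) := by
      field_simp
      linear_combination ‖c‖ * hacn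
    rw [this]
    exact mul_le_of_le_one_right (norm_nonneg _) ((div_le_one h1s').2 hlt.le)
  have heq : smallRoot a b c = -2 * c / b / (1 + s) := by
    refine (hfac _ hspec.1).resolve_right fun h => ?_
    have h1 := hbig _ h
    have h2 := hspec.2 _ hroot
    refine absurd (h1.trans_le ?_) (not_lt.2 hsmall)
    simp only [norm_mul a, norm_pow]
    gcongr
  refine ⟨heq, fun t ht hlt => ?_⟩
  rw [heq]
  exact (hfac t ht).resolve_right fun h => absurd (hbig t h) (not_lt.2 hlt.le)

/-- The product of the roots bounds the modulus of the smaller root. -/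
theorem norm_mul_smallRoot_sq_le {a b c : ℂ} (h : a ≠ 0 ∨ b ≠ 0) :
    ‖a * smallRoot a b c ^ 2‖ ≤ ‖c‖ := by
  obtain ⟨h1, h2⟩ := smallRoot_spec (c := c) h
  by_cases ha : a = 0
  · simp [ha]
  set t := smallRoot a b c
  have h3 := h2 (-b / a - t) (by field_simp; linear_combination a * h1)
  have h4 : c = a * (t * (-b / a - t)) := by field_simp; linear_combination h1
  rw [h4, norm_mul, norm_mul, norm_mul, norm_pow, sq]
  gcongr

/-- The roots are conjugate or equal, so |t|² is their product c/a. -/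
theorem norm_sq_root_of_discrim_nonpos {a b c : ℝ} {t : ℂ} (ha : 0 < a)
    (hd : b ^ 2 ≤ 4 * a * c) (h : a * t ^ 2 + b * t + c = 0) : a * ‖t‖ ^ 2 = c := by
  obtain ⟨p, q⟩ := t
  have hre := congrArg Complex.re h
  have him := congrArg Complex.im h
  simp [sq] at hre him
  rw [← Complex.normSq_eq_norm_sq, Complex.normSq_mk]
  by_cases hq : q = 0
  · subst hq
    have h2 : (2 * a * p + b) ^ 2 = 0 := by
      apply le_antisymm _ (sq_nonneg _)
      nlinarith
    have h3 : 2 * a * p + b = 0 := by simpa using h2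
    have h4 : b = -(2 * a * p) := by linarith
    subst h4
    linarith
  · have h4 : b = -(2 * a * p) := by
      have : q * (2 * a * p + b) = 0 := by linarith
      rcases mul_eq_zero.1 this with h | h
      · exact absurd h hq
      · linarith
    subst h4
    linarith

/-- The roots of a palindromic quadratic polynomial with positive discriminant are real. -/
theorem exists_real_root {A B : ℝ} {t : ℂ} (hA : 0 < A) (hB : 2 * A < B)
    (h : A * t ^ 2 - B * t + A = 0) : ∃ p : ℝ, t = p ∧ 0 < p ∧ A * p ^ 2 - B * p + A = 0 := by
  have hd : (0 : ℝ) ≤ B ^ 2 - 4 * A ^ 2 := by nlinarith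
  have hs := Real.sq_sqrt hd
  set s := √(B ^ 2 - 4 * A ^ 2)
  have hs' : (s : ℂ) ^ 2 = B ^ 2 - 4 * A ^ 2 := by exact_mod_cast hs
  have hA' : (A : ℂ) ≠ 0 := by exact_mod_cast hA.ne'
  have key : (2 * A * t - B - s) * (2 * A * t - B + s) = 0 := by
    linear_combination 4 * A * h - hs'
  have : ∃ p : ℝ, t = p := by
    rcases mul_eq_zero.1 key with h1 | h1
    · refine ⟨(B + s) / (2 * A), ?_⟩
      push_cast
      field_simp
      linear_combination h1
    · refine ⟨(B - s) / (2 * A), ?_⟩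
      push_cast
      field_simp
      linear_combination h1
  obtain ⟨p, rfl⟩ := this
  have hp : A * p ^ 2 - B * p + A = 0 := by exact_mod_cast h
  refine ⟨p, rfl, ?_, hp⟩
  by_contra hneg
  nlinarith [mul_nonneg (sub_nonneg.2 (not_lt.1 hneg)) (by linarith : 0 ≤ B), sq_nonneg p]

theorem cpow_half_sq (D : ℂ) : (D ^ (1 / 2 : ℂ)) ^ 2 = D := by
  rw [← Complex.cpow_nat_mul]
  norm_num

theorem re_cpow_half_pos {D : ℂ} (hD : D ∈ Complex.slitPlane) : 0 < (D ^ (1 / 2 : ℂ)).re := by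
  rw [Complex.cpow_def_of_ne_zero (Complex.slitPlane_ne_zero hD), Complex.exp_re]
  refine mul_pos (Real.exp_pos _) (Real.cos_pos_of_mem_Ioo ?_)
  have him : (Complex.log D * (1 / 2 : ℂ)).im = D.arg / 2 := by
    rw [show (1 / 2 : ℂ) = ((1 / 2 : ℝ) : ℂ) by norm_num, Complex.im_mul_ofReal, Complex.log_im]
    ring
  rw [him]
  have h1 := Complex.neg_pi_lt_arg D
  have h2 := lt_of_le_of_ne (Complex.arg_le_pi D) (Complex.mem_slitPlane_iff_arg.1 hD).1
  constructor <;> linarith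

theorem eq_smallRoot {a b c t : ℂ} (hb : b ≠ 0) (hD : 1 - 4 * a * c / b ^ 2 ∈ Complex.slitPlane)
    (h : a * t ^ 2 + b * t + c = 0) (hlt : ‖a * t ^ 2‖ < ‖c‖) : t = smallRoot a b c :=
  (smallRoot_formula hb (cpow_half_sq _) (re_cpow_half_pos hD)).2 t h hlt

/-- On the slit plane the principal square root is holomorphic with positive real part, so the
denominator 1 + s of the closed form never vanishes. -/
theorem differentiableOn_smallRoot {a b c : ℂ → ℂ} {U : Set ℂ} (ha : Differentiable ℂ a)
    (hb : Differentiable ℂ b) (hc : Differentiable ℂ c)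
    (hU : ∀ w ∈ U, b w ≠ 0 ∧ 1 - 4 * a w * c w / b w ^ 2 ∈ Complex.slitPlane) :
    DifferentiableOn ℂ (fun w => smallRoot (a w) (b w) (c w)) U := by
  refine DifferentiableOn.congr (f := fun w => -2 * c w / b w /
    (1 + (1 - 4 * a w * c w / b w ^ 2) ^ (1 / 2 : ℂ))) (fun w hw => ?_) fun w hw =>
    (smallRoot_formula (hU w hw).1 (cpow_half_sq _) (re_cpow_half_pos (hU w hw).2)).1
  obtain ⟨h1, h2⟩ := hU w hw
  have hD : DifferentiableAt ℂ (fun w => 1 - 4 * a w * c w / b w ^ 2) w :=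
    ((((ha w).const_mul 4).mul (hc w)).div ((hb w).pow 2) (pow_ne_zero 2 h1)).const_sub 1
  have h3 : 1 + (1 - 4 * a w * c w / b w ^ 2) ^ (1 / 2 : ℂ) ≠ 0 := fun h => by
    have := congrArg Complex.re h
    have := re_cpow_half_pos h2
    simp only [Complex.add_re, Complex.one_re, Complex.zero_re] at *
    linarith
  exact ((((hc w).const_mul (-2)).div (hb w) h1).div
    ((hD.cpow (differentiableAt_const _) h2).const_add 1) h3).differentiableWithinAt

/-- A complex number off the slit plane is `1 - t` with `t ≥ 1`. -/
theorem exists_of_notMem_slitPlane {D : ℂ} (h : 1 - D ∉ Complex.slitPlane) :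
    ∃ t : ℝ, 1 ≤ t ∧ D = t := by
  simp only [Complex.mem_slitPlane_iff, not_or, not_lt, not_not, Complex.sub_re, Complex.one_re,
    Complex.sub_im, Complex.one_im] at h
  exact ⟨D.re, by linarith [h.1], Complex.ext rfl (by simpa using h.2)⟩

/-! ### The cuts and the discriminants of the kernel -/

section Cuts

variable {z : ℝ}

theorem x₂_lt_one (hz0 : 0 < z) (hz1 : z < 1 / 4) : x₂ z < 1 := by
  have h1 : 0 < √(1 - 4 * z) := Real.sqrt_pos.2 (by linarith)
  have h2 := Real.sq_sqrt (by linarith : 0 ≤ 1 - 4 * z)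
  rw [x₂, div_lt_one (by linarith)]
  nlinarith

theorem one_lt_x₃ (hz0 : 0 < z) (hz1 : z < 1 / 4) : 1 < x₃ z := by
  have h1 := Real.sqrt_nonneg (1 - 4 * z)
  rw [x₃, one_lt_div (by linarith)]
  linarith

theorem y₂_lt_one (hz0 : 0 < z) (hz1 : z < 1 / 4) : y₂ z < 1 := by
  have h0 : 0 < 1 - 16 * z ^ 2 := by nlinarith
  have h1 : 0 < √(1 - 16 * z ^ 2) := Real.sqrt_pos.2 h0
  have h2 := Real.sq_sqrt h0.le
  have h3 : √(1 - 16 * z ^ 2) < 1 := by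
    rw [Real.sqrt_lt' one_pos]
    nlinarith
  rw [y₂, div_lt_one (by positivity)]
  nlinarith

theorem one_lt_y₃ (hz0 : 0 < z) (hz1 : z < 1 / 4) : 1 < y₃ z := by
  have h0 : 0 < 1 - 16 * z ^ 2 := by nlinarith
  have h1 := Real.sqrt_nonneg (1 - 16 * z ^ 2)
  rw [y₃, one_lt_div (by positivity)]
  linarith

theorem notMem_cutX34_of_norm_le_one (hz0 : 0 < z) (hz1 : z < 1 / 4) {x : ℂ} (hx : ‖x‖ ≤ 1) :
    x ∉ cutX34 z := by
  rintro ⟨p, hp, rfl⟩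
  rw [Complex.norm_real, Real.norm_eq_abs] at hx
  linarith [hp.1, le_abs_self p, one_lt_x₃ hz0 hz1]

theorem notMem_cutY34_of_norm_le_one (hz0 : 0 < z) (hz1 : z < 1 / 4) {y : ℂ} (hy : ‖y‖ ≤ 1) :
    y ∉ cutY34 z := by
  rintro ⟨p, hp, rfl⟩
  rw [Complex.norm_real, Real.norm_eq_abs] at hy
  linarith [Set.mem_Ici.1 hp, le_abs_self p, one_lt_y₃ hz0 hz1]

theorem notMem_cutX12_of_one_le_norm (hz0 : 0 < z) (hz1 : z < 1 / 4) {x : ℂ} (hx : 1 ≤ ‖x‖) :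
    x ∉ cutX12 z := by
  rintro ⟨p, hp, rfl⟩
  have h1 : 0 < x₁ z := by
    have h2 : √(1 + 4 * z) < 1 + 2 * z := by
      rw [Real.sqrt_lt' (by linarith)]
      nlinarith
    exact div_pos (by linarith) (by linarith)
  rw [Complex.norm_real, Real.norm_eq_abs, abs_of_nonneg (by linarith [hp.1])] at hx
  linarith [hp.2, x₂_lt_one hz0 hz1]

theorem notMem_cutY12_of_one_le_norm (hz0 : 0 < z) (hz1 : z < 1 / 4) {y : ℂ} (hy : 1 ≤ ‖y‖) :
    y ∉ cutY12 z := by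
  rintro ⟨p, hp, rfl⟩
  rw [Complex.norm_real, Real.norm_eq_abs, abs_of_nonneg hp.1] at hy
  linarith [hp.2, y₂_lt_one hz0 hz1]

theorem isClosed_cutX34 : IsClosed (cutX34 z) :=
  (isCompact_Icc.image Complex.continuous_ofReal).isClosed

theorem isClosed_cutY34 : IsClosed (cutY34 z) :=
  Complex.isometry_ofReal.isClosedEmbedding.isClosedMap _ isClosed_Ici

/-- The values σ = 2 and σ = -2 give the endpoints x₁, x₄ and x₂, x₃. As z < 1/4, the palindromic
equation has real positive roots; such a root makes the σ = 2 polynomial nonpositive and the σ = -2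
one nonnegative. -/
theorem mem_cutX (hz0 : 0 < z) (hz1 : z < 1 / 4) {x : ℂ} {σ : ℝ} (h1 : -2 ≤ σ) (h2 : σ ≤ 2)
    (h : z * x ^ 2 - x + z = σ * z * x) : x ∈ cutX12 z ∪ cutX34 z := by
  obtain ⟨p, rfl, hp0, hp⟩ := exists_real_root (A := z) (B := 1 + σ * z) (t := x) hz0
    (by nlinarith) (by push_cast; linear_combination h)
  have h2z : 0 < 2 * z := by linarith
  have hu : |2 * z * p - (1 + 2 * z)| ≤ √(1 + 4 * z) := by
    apply Real.abs_le_sqrt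
    have : 0 ≤ 4 * z ^ 2 * p * (2 - σ) := mul_nonneg (by positivity) (by linarith)
    linear_combination this + 4 * z * hp
  have hl : √(1 - 4 * z) ≤ |2 * z * p - (1 - 2 * z)| := by
    rw [← Real.sqrt_sq_eq_abs]
    apply Real.sqrt_le_sqrt
    have : 0 ≤ 4 * z ^ 2 * p * (σ + 2) := mul_nonneg (by positivity) (by linarith)
    linear_combination this - 4 * z * hp
  obtain ⟨hu1, hu2⟩ := abs_le.1 hu
  rcases le_abs'.1 hl with hl | hl
  · refine Or.inl ⟨p, ⟨?_, ?_⟩, rfl⟩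
    · rw [x₁, div_le_iff₀ h2z]
      linarith
    · rw [x₂, le_div_iff₀ h2z]
      linarith
  · refine Or.inr ⟨p, ⟨?_, ?_⟩, rfl⟩
    · rw [x₃, div_le_iff₀ h2z]
      linarith
    · rw [x₄, le_div_iff₀ h2z]
      linarith

/-- The case t = 1 gives y₂ and y₃; for t ≥ 1 the real positive root makes that polynomial
nonnegative, so it avoids the open interval between them. -/
theorem mem_cutY (hz0 : 0 < z) (hz1 : z < 1 / 4) {y : ℂ} {t : ℝ} (ht : 1 ≤ t)
    (h : 4 * z ^ 2 * (y + 1) ^ 2 = t * y) : y ∈ cutY12 z ∪ cutY34 z := by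
  have h16 : 16 * z ^ 2 < 1 := by nlinarith
  obtain ⟨p, rfl, hp0, hp⟩ := exists_real_root (A := 4 * z ^ 2) (B := t - 8 * z ^ 2) (t := y)
    (by positivity) (by linarith) (by push_cast; linear_combination h)
  have h8z : 0 < 8 * z ^ 2 := by positivity
  have hl : √(1 - 16 * z ^ 2) ≤ |8 * z ^ 2 * p - (1 - 8 * z ^ 2)| := by
    rw [← Real.sqrt_sq_eq_abs]
    apply Real.sqrt_le_sqrt
    have : 0 ≤ 16 * z ^ 2 * p * (t - 1) := mul_nonneg (by positivity) (by linarith)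
    linear_combination this - 16 * z ^ 2 * hp
  rcases le_abs'.1 hl with hl | hl
  · refine Or.inl ⟨p, ⟨hp0.le, ?_⟩, rfl⟩
    rw [y₂, le_div_iff₀ h8z]
    linarith
  · refine Or.inr ⟨p, ?_, rfl⟩
    rw [Set.mem_Ici, y₃, div_le_iff₀ h8z]
    linarith

/-- Over the cut `[x₃, x₄]`, the two roots `y` of the kernel have modulus `1 / |x|`. -/
theorem norm_mul_eq_one_of_mem_cutX34 (hz0 : 0 < z) (hz1 : z < 1 / 4) {x y : ℂ}
    (hx : x ∈ cutX34 z) (h : kernel x y z = 0) : ‖x * y‖ = 1 := by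
  obtain ⟨p, ⟨h3, h4⟩, rfl⟩ := hx
  have hp := h3.trans' (one_lt_x₃ hz0 hz1).le
  have h2z : 0 < 2 * z := by linarith
  rw [x₃, div_le_iff₀ h2z] at h3
  rw [x₄, le_div_iff₀ h2z] at h4
  have hs0 := Real.sqrt_nonneg (1 - 4 * z)
  have hs := Real.sq_sqrt (by linarith : 0 ≤ 1 - 4 * z)
  have hw := Real.sq_sqrt (by linarith : 0 ≤ 1 + 4 * z)
  have hw1 : 1 ≤ √(1 + 4 * z) := Real.one_le_sqrt.2 (by linarith)
  set s := √(1 - 4 * z)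
  set w := √(1 + 4 * z)
  -- Together `e1` and `e2` say |b| ≤ 2zp, that is b² ≤ 4ac for the kernel as a polynomial in y.
  have e1 : 0 ≤ z * p ^ 2 - p + z + 2 * z * p := by
    have : 0 ≤ 4 * z * (z * p ^ 2 - p + z + 2 * z * p) := by nlinarith
    exact nonneg_of_mul_nonneg_right this (by linarith)
  have e2 : 0 ≤ 2 * z * p - (z * p ^ 2 - p + z) := by
    have : 0 ≤ 4 * z * (2 * z * p - (z * p ^ 2 - p + z)) := by
      nlinarith [mul_nonneg (by linarith : 0 ≤ w - (p * (2 * z) - (1 + 2 * z)))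
        (by linarith : 0 ≤ w + (p * (2 * z) - (1 + 2 * z)))]
    exact nonneg_of_mul_nonneg_right this (by linarith)
  have key := norm_sq_root_of_discrim_nonpos (a := z * p ^ 2) (b := z * p ^ 2 - p + z) (c := z)
    (t := y) (by positivity) (by nlinarith [mul_nonneg e1 e2])
    (by unfold kernel at h; push_cast; linear_combination h)
  rw [norm_mul, Complex.norm_real, Real.norm_eq_abs, abs_of_nonneg (by linarith)]
  refine (pow_eq_one_iff_of_nonneg (by positivity) two_ne_zero).1 ?_
  refine mul_left_cancel₀ hz0.ne' ?_
  linear_combination key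

/-- Over the cut `[y₃, ∞)`, the two roots `x` of the kernel have modulus `1 / √|y|`. -/
theorem norm_sq_mul_eq_one_of_mem_cutY34 (hz0 : 0 < z) (hz1 : z < 1 / 4) {x y : ℂ}
    (hy : y ∈ cutY34 z) (h : kernel x y z = 0) : ‖x‖ ^ 2 * ‖y‖ = 1 := by
  obtain ⟨p, h3, rfl⟩ := hy
  have h3 : y₃ z ≤ p := h3
  have hp := h3.trans' (one_lt_y₃ hz0 hz1).le
  have h8z : 0 < 8 * z ^ 2 := by positivity
  rw [y₃, div_le_iff₀ h8z] at h3
  have h0 : 0 < 1 - 16 * z ^ 2 := by nlinarith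
  have hs0 := Real.sqrt_nonneg (1 - 16 * z ^ 2)
  have hs := Real.sq_sqrt h0.le
  set s := √(1 - 16 * z ^ 2)
  have e1 : 0 ≤ 4 * z ^ 2 * (p + 1) ^ 2 - p := by
    have : 0 ≤ 16 * z ^ 2 * (4 * z ^ 2 * (p + 1) ^ 2 - p) := by nlinarith
    exact nonneg_of_mul_nonneg_right this (by positivity)
  have key := norm_sq_root_of_discrim_nonpos (a := z * p * (p + 1)) (b := -p) (c := z * (p + 1))
    (t := x) (by positivity) (by nlinarith)
    (by unfold kernel at h; push_cast; linear_combination h)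
  rw [Complex.norm_real, Real.norm_eq_abs, abs_of_nonneg (by linarith)]
  refine mul_left_cancel₀ (by positivity : z * (p + 1) ≠ 0) ?_
  linear_combination key

theorem slitPlane_of_notMem_cutX (hz0 : 0 < z) (hz1 : z < 1 / 4) {x : ℂ}
    (hx : x ∉ cutX12 z ∪ cutX34 z) : (z * x ^ 2 - x + z : ℂ) ≠ 0 ∧
      1 - 4 * (z * x ^ 2) * z / (z * x ^ 2 - x + z) ^ 2 ∈ Complex.slitPlane := by
  have hz : (z : ℂ) ≠ 0 := by exact_mod_cast hz0.ne'
  have hb : (z * x ^ 2 - x + z : ℂ) ≠ 0 := fun h =>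
    hx (mem_cutX hz0 hz1 (σ := 0) (by norm_num) (by norm_num) (by simpa using h))
  refine ⟨hb, ?_⟩
  by_contra hD
  obtain ⟨t, ht, h⟩ := exists_of_notMem_slitPlane hD
  have hr1 : 1 ≤ √t := Real.one_le_sqrt.2 ht
  have hr : ((√t : ℝ) : ℂ) ^ 2 = t := by exact_mod_cast Real.sq_sqrt (by linarith : 0 ≤ t)
  set r := √t
  have hr0 : (r : ℂ) ≠ 0 := by
    have : r ≠ 0 := by linarith
    exact_mod_cast this
  have hle : 2 / r ≤ 2 := div_le_self (by norm_num) hr1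
  have hnn : 0 ≤ 2 / r := by positivity
  rw [div_eq_iff (pow_ne_zero 2 hb), ← hr] at h
  -- A difference of squares: D = t yields σ = ±2/√t, which lies in [-2, 2].
  have h2 : (r * (z * x ^ 2 - x + z) - 2 * z * x) * (r * (z * x ^ 2 - x + z) + 2 * z * x) = 0 := by
    linear_combination -h
  rcases mul_eq_zero.1 h2 with h2 | h2
  · refine hx (mem_cutX hz0 hz1 (σ := 2 / r) (by linarith) hle ?_)
    push_cast
    field_simp
    linear_combination h2
  · refine hx (mem_cutX hz0 hz1 (σ := -(2 / r)) (by linarith) (by linarith) ?_)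
    push_cast
    field_simp
    linear_combination h2

theorem slitPlane_of_notMem_cutY (hz0 : 0 < z) (hz1 : z < 1 / 4) {y : ℂ}
    (hy : y ∉ cutY12 z ∪ cutY34 z) : -y ≠ 0 ∧
      1 - 4 * (z * y * (y + 1)) * (z * (y + 1)) / (-y) ^ 2 ∈ Complex.slitPlane := by
  have hy0 : y ≠ 0 := by
    rintro rfl
    refine hy (Or.inl ⟨0, ⟨le_rfl, ?_⟩, by simp⟩)
    have h16 : 16 * z ^ 2 < 1 := by nlinarith
    refine div_nonneg (sub_nonneg.2 (Real.sqrt_le_iff.2 ⟨by linarith, ?_⟩)) (by positivity)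
    nlinarith [sq_nonneg (z ^ 2)]
  refine ⟨neg_ne_zero.2 hy0, ?_⟩
  by_contra hD
  obtain ⟨t, ht, h⟩ := exists_of_notMem_slitPlane hD
  refine hy (mem_cutY hz0 hz1 ht ?_)
  rw [← h]
  field_simp

end Cuts

end Gessel

/-! ### Construction of the continuations and the kernel relations -/

theorem theorem3 (z : ℝ) (hz0 : 0 < z) (hz1 : z < 1 / 4) :
    (∀ x y : ℂ, ‖x‖ ≤ 1 → ‖y‖ ≤ 1 → Summable (Gessel.QTerm x y z)) ∧
    ∃ F G : ℂ → ℂ,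
      -- `F` continues `z Q(x,0,z)` and `G` continues `z (y+1) Q(0,y,z)`
      DifferentiableOn ℂ F (Gessel.cutX34 z)ᶜ ∧
      (∀ x : ℂ, ‖x‖ ≤ 1 → x ∉ Gessel.cutX34 z ∧ F x = z * Gessel.Q x 0 z) ∧
      DifferentiableOn ℂ G (Gessel.cutY34 z)ᶜ ∧
      (∀ y : ℂ, ‖y‖ ≤ 1 → y ∉ Gessel.cutY34 z ∧ G y = z * (y + 1) * Gessel.Q 0 y z) ∧
      -- the kernel relations, evaluated inside the domains of `F` and `G`
      (∀ y : ℂ, y ∉ Gessel.cutY12 z ∪ Gessel.cutY34 z →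
        Gessel.X₀ y z ∉ Gessel.cutX34 z ∧
        F (Gessel.X₀ y z) + G y - z * Gessel.Q 0 0 z - Gessel.X₀ y z * y = 0) ∧
      (∀ x : ℂ, x ∉ Gessel.cutX12 z ∪ Gessel.cutX34 z →
        Gessel.Y₀ x z ∉ Gessel.cutY34 z ∧
        F x + G (Gessel.Y₀ x z) - z * Gessel.Q 0 0 z - x * Gessel.Y₀ x z = 0) := by
  open Gessel in
  have hz : (z : ℂ) ≠ 0 := by exact_mod_cast hz0.ne'
  have hzn : ‖(z : ℂ)‖ = z := by rw [Complex.norm_real, Real.norm_eq_abs, abs_of_pos hz0]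
  refine ⟨fun x y hx hy => summable_QTerm le_rfl le_rfl hx hy (by rw [hzn]; linarith), ?_⟩
  -- a radius of convergence larger than one
  obtain ⟨r, hr1, hr⟩ : ∃ r : ℝ, 1 < r ∧ 4 * r * z < 1 := by
    obtain ⟨r, h1, h2⟩ := exists_between ((one_lt_div (by linarith)).2 (by linarith) :
      1 < 1 / (4 * z))
    rw [lt_div_iff₀ (by linarith)] at h2
    exact ⟨r, h1, by linarith⟩
  -- Only one variable at a time may exceed 1 in modulus: 4rz < 1 is available, 4r²z < 1 is not.
  have fe1 : ∀ x y : ℂ, ‖x‖ < r → ‖y‖ ≤ 1 → kernel x y z = 0 →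
      z * Q x 0 z + z * (y + 1) * Q 0 y z - z * Q 0 0 z - x * y = 0 := fun x y hx hy h => by
    rw [← kernel_mul_Q hr1.le le_rfl hx.le hy (by rw [hzn]; linarith), h, zero_mul]
  have fe2 : ∀ x y : ℂ, ‖x‖ ≤ 1 → ‖y‖ < r → kernel x y z = 0 →
      z * Q x 0 z + z * (y + 1) * Q 0 y z - z * Q 0 0 z - x * y = 0 := fun x y hx hy h => by
    rw [← kernel_mul_Q le_rfl hr1.le hx hy.le (by rw [hzn]; linarith), h, zero_mul]
  have kY : ∀ x, kernel x (Y₀ x z) z = 0 := fun x => (Y₀_spec x hz).1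
  have kX : ∀ y, y ≠ 0 → kernel (X₀ y z) y z = 0 := fun y hy => (X₀_spec _ hy).1
  -- the products of the roots
  have nY : ∀ x, ‖x * Y₀ x z‖ ≤ 1 := fun x => by
    have h := norm_mul_smallRoot_sq_le (a := z * x ^ 2) (b := z * x ^ 2 - x + z) (c := z) (by
      by_cases hx : x = 0
      · right
        simpa [hx] using hz
      · left
        exact mul_ne_zero hz (pow_ne_zero 2 hx))
    rw [mul_assoc, norm_mul, ← mul_pow, norm_pow] at h
    have h1 : ‖x * Y₀ x z‖ ^ 2 ≤ 1 := (mul_le_iff_le_one_right (norm_pos_iff.2 hz)).1 h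
    exact (sq_le_one_iff₀ (norm_nonneg _)).1 h1
  have nX : ∀ y, y ≠ 0 → ‖X₀ y z‖ ^ 2 * ‖y‖ ≤ 1 := fun y hy => by
    by_cases hy1 : y + 1 = 0
    -- At y = -1 the outer coefficients both vanish and X₀ = 0.
    · simp [X₀, smallRoot, hy1]
    · have h := norm_mul_smallRoot_sq_le (a := z * y * (y + 1)) (b := -y) (c := z * (y + 1))
        (Or.inr (neg_ne_zero.2 hy))
      have hp : 0 < ‖(z : ℂ) * (y + 1)‖ := norm_pos_iff.2 (mul_ne_zero hz hy1)
      have e : ‖z * y * (y + 1) * X₀ y z ^ 2‖ = ‖(z : ℂ) * (y + 1)‖ * (‖X₀ y z‖ ^ 2 * ‖y‖) := by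
        simp only [norm_mul, norm_pow]
        ring
      exact (mul_le_iff_le_one_right hp).1 (e.symm.trans_le h)
  have nY1 : ∀ x : ℂ, 1 ≤ ‖x‖ → ‖Y₀ x z‖ ≤ 1 := fun x hx => by
    have := nY x
    rw [norm_mul] at this
    nlinarith [norm_nonneg (Y₀ x z)]
  have nX1 : ∀ y : ℂ, 1 ≤ ‖y‖ → ‖X₀ y z‖ ≤ 1 := fun y hy => by
    have := nX y (norm_pos_iff.1 (by linarith))
    refine (sq_le_one_iff₀ (norm_nonneg _)).1 ?_
    nlinarith [sq_nonneg ‖X₀ y z‖]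
  -- strictly smaller roots
  have uY : ∀ x y : ℂ, x ∉ cutX12 z ∪ cutX34 z → kernel x y z = 0 → ‖x * y‖ < 1 → y = Y₀ x z := by
    intro x y hx h hlt
    obtain ⟨hb, hD⟩ := slitPlane_of_notMem_cutX hz0 hz1 hx
    refine eq_smallRoot hb hD (by unfold kernel at h; linear_combination h) ?_
    rw [mul_assoc, norm_mul, ← mul_pow, norm_pow]
    exact mul_lt_of_lt_one_right (norm_pos_iff.2 hz)
      (pow_lt_one₀ (norm_nonneg _) hlt two_ne_zero)
  have uX : ∀ x y : ℂ, y ∉ cutY12 z ∪ cutY34 z → 1 < ‖y‖ → kernel x y z = 0 →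
      ‖x‖ ^ 2 * ‖y‖ < 1 → x = X₀ y z := by
    intro x y hy hy1 h hlt
    obtain ⟨hb, hD⟩ := slitPlane_of_notMem_cutY hz0 hz1 hy
    refine eq_smallRoot hb hD (by unfold kernel at h; linear_combination h) ?_
    have hp : 0 < ‖(z : ℂ) * (y + 1)‖ := by
      refine norm_pos_iff.2 (mul_ne_zero hz fun h => ?_)
      rw [eq_neg_of_add_eq_zero_left h] at hy1
      simp at hy1
    refine lt_of_eq_of_lt ?_ (mul_lt_of_lt_one_right hp hlt)
    simp only [norm_mul, norm_pow]
    ring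
  have neY : ∀ y, y ∉ cutY12 z ∪ cutY34 z → y ≠ 0 := fun y hy =>
    neg_ne_zero.1 (slitPlane_of_notMem_cutY hz0 hz1 hy).1
  -- the continuations
  classical
  let F : ℂ → ℂ := fun x => if ‖x‖ < r then z * Q x 0 z else
    z * Q 0 0 z + x * Y₀ x z - z * (Y₀ x z + 1) * Q 0 (Y₀ x z) z
  let G : ℂ → ℂ := fun y => if ‖y‖ < r then z * (y + 1) * Q 0 y z else
    z * Q 0 0 z + X₀ y z * y - z * Q (X₀ y z) 0 z
  have F1 : ∀ x, ‖x‖ < r → F x = z * Q x 0 z := fun x hx => if_pos hx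
  have G1 : ∀ y, ‖y‖ < r → G y = z * (y + 1) * Q 0 y z := fun y hy => if_pos hy
  -- On the annulus 1 ≤ |x| < r the functional equation at (x, Y₀) identifies both branches of `F`,
  -- so no gluing is needed at |x| = r.
  have F2 : ∀ x, 1 ≤ ‖x‖ →
      F x = z * Q 0 0 z + x * Y₀ x z - z * (Y₀ x z + 1) * Q 0 (Y₀ x z) z := by
    intro x hx
    by_cases hxr : ‖x‖ < r
    · rw [F1 x hxr]
      linear_combination fe1 x _ hxr (nY1 x hx) (kY x)
    · exact if_neg hxr
  have G2 : ∀ y, 1 ≤ ‖y‖ → G y = z * Q 0 0 z + X₀ y z * y - z * Q (X₀ y z) 0 z := by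
    intro y hy
    by_cases hyr : ‖y‖ < r
    · rw [G1 y hyr]
      linear_combination fe2 _ y (nX1 y hy) hyr (kX y (norm_pos_iff.1 (by linarith)))
    · exact if_neg hyr
  have dQ1 := differentiableOn_Q_left (z := z) hr1.le (by rw [hzn]; exact hr)
  have dQ2 := differentiableOn_Q_right (z := z) hr1.le (by rw [hzn]; exact hr)
  have hbig : IsOpen {w : ℂ | 1 < ‖w‖} := isOpen_lt continuous_const continuous_norm
  have relX : ∀ x, 1 ≤ ‖x‖ → F x + G (Y₀ x z) - z * Q 0 0 z - x * Y₀ x z = 0 := fun x hx => by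
    rw [F2 x hx, G1 _ ((nY1 x hx).trans_lt hr1)]
    ring
  have relY : ∀ y, 1 ≤ ‖y‖ → F (X₀ y z) + G y - z * Q 0 0 z - X₀ y z * y = 0 := fun y hy => by
    rw [G2 y hy, F1 _ ((nX1 y hy).trans_lt hr1)]
    ring
  refine ⟨F, G, ?_, fun x hx => ⟨notMem_cutX34_of_norm_le_one hz0 hz1 hx, F1 x (hx.trans_lt hr1)⟩,
    ?_, fun y hy => ⟨notMem_cutY34_of_norm_le_one hz0 hz1 hy, G1 y (hy.trans_lt hr1)⟩, ?_, ?_⟩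
  · intro x hx
    refine DifferentiableAt.differentiableWithinAt ?_
    by_cases hxr : ‖x‖ < r
    · have hn : Metric.ball (0 : ℂ) r ∈ nhds x :=
        Metric.isOpen_ball.mem_nhds (mem_ball_zero_iff.2 hxr)
      refine ((dQ1.differentiableAt hn).const_mul (z : ℂ)).congr_of_eventuallyEq ?_
      filter_upwards [hn] with w hw using F1 w (mem_ball_zero_iff.1 hw)
    · have hU : IsOpen ({w : ℂ | 1 < ‖w‖} ∩ (cutX34 z)ᶜ) := hbig.inter isClosed_cutX34.isOpen_compl
      have hxU : {w : ℂ | 1 < ‖w‖} ∩ (cutX34 z)ᶜ ∈ nhds x :=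
        hU.mem_nhds ⟨hr1.trans_le (not_lt.1 hxr), hx⟩
      have dY : DifferentiableAt ℂ (fun w => Y₀ w z) x :=
        (differentiableOn_smallRoot (by fun_prop) (by fun_prop) (by fun_prop) fun w hw =>
          slitPlane_of_notMem_cutX hz0 hz1 fun h =>
            h.elim (notMem_cutX12_of_one_le_norm hz0 hz1 hw.1.le) hw.2).differentiableAt hxU
      have hY1 : ‖Y₀ x z‖ < r := (nY1 x (hr1.le.trans (not_lt.1 hxr))).trans_lt hr1
      have dQ : DifferentiableAt ℂ (fun w => Q 0 (Y₀ w z) z) x :=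
        DifferentiableAt.comp (g := fun y => Q 0 y z) x
          (dQ2.differentiableAt (Metric.isOpen_ball.mem_nhds (mem_ball_zero_iff.2 hY1))) dY
      refine DifferentiableAt.congr_of_eventuallyEq (f := fun x => z * Q 0 0 z + x * Y₀ x z -
        z * (Y₀ x z + 1) * Q 0 (Y₀ x z) z) (by fun_prop) ?_
      filter_upwards [hxU] with w hw using F2 w hw.1.le
  · intro y hy
    refine DifferentiableAt.differentiableWithinAt ?_
    by_cases hyr : ‖y‖ < r
    · have hn : Metric.ball (0 : ℂ) r ∈ nhds y :=
        Metric.isOpen_ball.mem_nhds (mem_ball_zero_iff.2 hyr)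
      have := dQ2.differentiableAt hn
      refine DifferentiableAt.congr_of_eventuallyEq (f := fun y => z * (y + 1) * Q 0 y z)
        (by fun_prop) ?_
      filter_upwards [hn] with w hw using G1 w (mem_ball_zero_iff.1 hw)
    · have hU : IsOpen ({w : ℂ | 1 < ‖w‖} ∩ (cutY34 z)ᶜ) := hbig.inter isClosed_cutY34.isOpen_compl
      have hyU : {w : ℂ | 1 < ‖w‖} ∩ (cutY34 z)ᶜ ∈ nhds y :=
        hU.mem_nhds ⟨hr1.trans_le (not_lt.1 hyr), hy⟩
      have dX : DifferentiableAt ℂ (fun w => X₀ w z) y :=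
        (differentiableOn_smallRoot (by fun_prop) (by fun_prop) (by fun_prop) fun w hw =>
          slitPlane_of_notMem_cutY hz0 hz1 fun h =>
            h.elim (notMem_cutY12_of_one_le_norm hz0 hz1 hw.1.le) hw.2).differentiableAt hyU
      have hX1 : ‖X₀ y z‖ < r := (nX1 y (hr1.le.trans (not_lt.1 hyr))).trans_lt hr1
      have dQ : DifferentiableAt ℂ (fun w => Q (X₀ w z) 0 z) y :=
        DifferentiableAt.comp (g := fun x => Q x 0 z) y
          (dQ1.differentiableAt (Metric.isOpen_ball.mem_nhds (mem_ball_zero_iff.2 hX1))) dX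
      refine DifferentiableAt.congr_of_eventuallyEq (f := fun y => z * Q 0 0 z + X₀ y z * y -
        z * Q (X₀ y z) 0 z) (by fun_prop) ?_
      filter_upwards [hyU] with w hw using G2 w hw.1.le
  · intro y hy
    have hk := kX y (neY y hy)
    have hn := nX y (neY y hy)
    by_cases hx1 : ‖X₀ y z‖ ≤ 1
    · refine ⟨notMem_cutX34_of_norm_le_one hz0 hz1 hx1, ?_⟩
      by_cases hy1 : ‖y‖ < 1
      · rw [F1 _ (hx1.trans_lt hr1), G1 _ (hy1.trans hr1)]
        exact fe2 _ y hx1 (hy1.trans hr1) hk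
      · exact relY y (not_lt.1 hy1)
    · have hx1 := not_le.1 hx1
      -- From |X₀|²|y| ≤ 1 and |X₀| > 1.
      have hlt : ‖X₀ y z * y‖ < 1 := by
        rw [norm_mul]
        have : 0 < ‖X₀ y z‖ * ‖y‖ := mul_pos (by linarith) (norm_pos_iff.2 (neY y hy))
        nlinarith
      have hx3 : X₀ y z ∉ cutX34 z := fun h =>
        hlt.ne (norm_mul_eq_one_of_mem_cutX34 hz0 hz1 h hk)
      -- y is the strictly smaller root over X₀(y), so the relation at x = X₀(y) applies with Y₀(x)
      -- = y.
      have hx := uY _ y (fun h => h.elim (notMem_cutX12_of_one_le_norm hz0 hz1 hx1.le) hx3) hk hlt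
      refine ⟨hx3, ?_⟩
      have := relX _ hx1.le
      rwa [← hx] at this
  · intro x hx
    have hk := kY x
    have hn := nY x
    by_cases hy1 : ‖Y₀ x z‖ ≤ 1
    · refine ⟨notMem_cutY34_of_norm_le_one hz0 hz1 hy1, ?_⟩
      by_cases hx1 : ‖x‖ < 1
      · rw [F1 _ (hx1.trans hr1), G1 _ (hy1.trans_lt hr1)]
        exact fe1 x _ (hx1.trans hr1) hy1 hk
      · exact relX x (not_lt.1 hx1)
    · have hy1 := not_le.1 hy1
      have hx1 : ‖x‖ < 1 := by
        rw [norm_mul] at hn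
        nlinarith [norm_nonneg x]
      -- |x|²|Y₀| = |x|·|xY₀| ≤ |x| < 1; hence x is the strictly smaller root over Y₀(x).
      have hlt : ‖x‖ ^ 2 * ‖Y₀ x z‖ < 1 := by
        rw [norm_mul] at hn
        nlinarith [norm_nonneg x]
      have hy3 : Y₀ x z ∉ cutY34 z := fun h =>
        hlt.ne (norm_sq_mul_eq_one_of_mem_cutY34 hz0 hz1 h hk)
      have hy := uX x _ (fun h => h.elim (notMem_cutY12_of_one_le_norm hz0 hz1 hy1.le) hy3) hy1 hk
        hlt
      refine ⟨hy3, ?_⟩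
      have := relY _ hy1.le
      rwa [← hy] at this
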